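/- All letters are taken from a fixed infinite set, and an alphabet $\Sigma$ is a finite set of letters. A \emph{repetitive finite automaton with translucent letters} $A=(Q,\Sigma,\lhd,\tau,I,\delta)$ consists of a finite set of states $Q$, an alphabet $\Sigma$, an end-of-tape marker $\lhd\notin\Sigma$, a translucency mapping $\tau:Q\to\mathcal P(\Sigma)$, a set $I\subseteq Q$ of initial states, and a transition relation $\delta$ on $Q\times(\Sigma\cup\{\lhd\})$ such that, for all $q\in Q$ and $a\in\Sigma$, $\delta(q,a)\subseteq Q$, $\delta(q,a)=\emptyset$ if $a\in\tau(q)$, and $\delta(q,\lhd)$ is either a subset of $Q$ or the symbol $\mathsf{Accept}$. A configuration is $\mathsf{Accept}$, $\mathsf{Reject}$, or a word $qw\lhd$ with $q\in Q$ and $w\in\Sigma^*$. In one step, $A$ can move from $qw\lhd$ as follows. \begin{itemize} \item If $w=uav$ with $u\in\tau(q)^*$, $a\in\Sigma\smallsetminus\tau(q)$, $v\in\Sigma^*$: to $q'uv\lhd$ for any $q'\in\delta(q,a)$, and to $\mathsf{Reject}$ if $\delta(q,a)=\emptyset$. \item If $w\in\tau(q)^*$: to $\mathsf{Accept}$ if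 $\delta(q,\lhd)=\mathsf{Accept}$, to $\mathsf{Reject}$ if $\delta(q,\lhd)=\emptyset$, and to $q'w\lhd$ for any $q'\in\delta(q,\lhd)$ if $\delta(q,\lhd)\subseteq Q$. \end{itemize} $A$ accepts $w\in\Sigma^*$ if $\mathsf{Accept}$ can be reached from $q_0w\lhd$ in finitely many steps for some $q_0\in I$. It is deterministic, an $\mathsf{RDFAwtl}$, if $|I|=1$, $|\delta(q,a)|\le 1$ for all $q\in Q$, $a\in\Sigma$, and, for each $q\in Q$, $\delta(q,\lhd)$ is $\mathsf{Accept}$ or a set with at most one element. A \emph{nondeterministic right one-way jumping finite automaton} ($\mathsf{NROWJFA}$) $J=(Q,\Sigma,\lhd,I,F,\delta)$ consists of a finite set of states $Q$, an alphabet $\Sigma$, an end-of-tape marker $\lhd\notin\Sigma$, sets $I,F\subseteq Q$ of initial and of final states, and a transition relation $\delta:Q\times\Sigma\to\mathcal P(Q)$. Let $\Sigma_q=\{a\in\Sigma\mid\delta(q,a)\ne\emptyset\}$. In one step, $J$ can move from $qxay\lhd$ to $q'yx\lhd$ whenever $x\in(\Sigma\smallsetminus\Sigma_q)^*$, $a\in\Sigma$,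 $y\in\Sigma^*$ and $q'\in\delta(q,a)$. $J$ accepts $w\in\Sigma^*$ if $q_f\lhd$ can be reached from $q_0w\lhd$ in finitely many (possibly zero) steps for some $q_0\in I$ and $q_f\in F$. It is deterministic, an $\mathsf{ROWJFA}$, if $|I|=1$ and $|\delta(q,a)|\le1$ for all $q\in Q$, $a\in\Sigma$. For a type $\mathsf X$ of automata, let $\mathcal L(\mathsf X)$ be the class of all languages accepted by automata of type $\mathsf X$. \textbf{Corollary.} The class $\mathcal L(\mathsf{RDFAwtl})$ is incomparable under inclusion with both $\mathcal L(\mathsf{ROWJFA})$ and $\mathcal L(\mathsf{NROWJFA})$. That is, $$\mathcal L(\mathsf{RDFAwtl})\not\subseteq\mathcal L(\mathsf{ROWJFA}),\quad \mathcal L(\mathsf{ROWJFA})\not\subseteq\mathcal L(\mathsf{RDFAwtl}),\quad \mathcal L(\mathsf{RDFAwtl})\not\subseteq\mathcal L(\mathsf{NROWJFA}),\quad \mathcal L(\mathsf{NROWJFA})\not\subseteq\mathcal L(\mathsf{RDFAwtl}).$$ -/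

import Mathlib

/-- What a repetitive automaton with translucent letters does at the end-of-tape marker: it
accepts, or it may move to any state of a given set (the empty set means rejection). -/
inductive EndAction (Q : Type*) where
  | accept : EndAction Q
  | goto (S : Set Q) : EndAction Q

/-- A repetitive (nondeterministic) finite automaton with translucent letters, with input
alphabet `α` and set of states `Q`. The value of the transition relation at a letter is `step`,
its value at the end-of-tape marker (which is not a letter) is `stepEnd`. Finiteness of `α` and
`Q` is demanded where the language classes are defined. -/
structure RNFAwtl (α Q : Type*) where
  /-- the translucency mapping -/
  transl : Q → Set α
  /-- the initial states -/
  init : Set Q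
  /-- the transitions on letters -/
  step : Q → α → Set Q
  /-- the transitions on the end-of-tape marker -/
  stepEnd : Q → EndAction Q
  /-- no transition reads a letter that is translucent for the current state -/
  step_eq_empty : ∀ q, ∀ a ∈ transl q, step q a = ∅

namespace RNFAwtl

/-- Configurations: a state together with the tape contents (without the end-of-tape marker; the
head is on the first symbol), or one of the two halting configurations. -/
inductive Config (α Q : Type*) where
  | run (q : Q) (w : List α) : Config α Q
  | accept : Config α Q
  | reject : Config α Q

variable {α Q : Type*}

/-- The single-step computation relation. -/
inductive Step (A : RNFAwtl α Q) : Config α Q → Config α Q → Prop where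
  | read (q q' : Q) (u v : List α) (a : α) (hu : ∀ x ∈ u, x ∈ A.transl q)
      (ha : a ∉ A.transl q) (h : q' ∈ A.step q a) :
      Step A (.run q (u ++ a :: v)) (.run q' (u ++ v))
  | stuck (q : Q) (u v : List α) (a : α) (hu : ∀ x ∈ u, x ∈ A.transl q)
      (ha : a ∉ A.transl q) (h : A.step q a = ∅) :
      Step A (.run q (u ++ a :: v)) .reject
  | endAccept (q : Q) (w : List α) (hw : ∀ x ∈ w, x ∈ A.transl q)
      (h : A.stepEnd q = .accept) :
      Step A (.run q w) .accept
  | endReject (q : Q) (w : List α) (hw : ∀ x ∈ w, x ∈ A.transl q)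
      (h : A.stepEnd q = .goto ∅) :
      Step A (.run q w) .reject
  | endGoto (q q' : Q) (w : List α) (S : Set Q) (hw : ∀ x ∈ w, x ∈ A.transl q)
      (h : A.stepEnd q = .goto S) (hq' : q' ∈ S) :
      Step A (.run q w) (.run q' w)

/-- The language accepted by a repetitive automaton with translucent letters. -/
def language (A : RNFAwtl α Q) : Set (List α) :=
  {w | ∃ q₀ ∈ A.init, Relation.ReflTransGen A.Step (.run q₀ w) .accept}

/-- `A` is deterministic, that is, an RDFAwtl: there is exactly one initial state, and there is
at most one successor state for each state and each symbol, including the end-of-tape marker. -/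
structure IsDeterministic (A : RNFAwtl α Q) : Prop where
  init_eq : ∃ q₀, A.init = {q₀}
  step_subsingleton : ∀ q a, (A.step q a).Subsingleton
  stepEnd_subsingleton : ∀ q S, A.stepEnd q = .goto S → S.Subsingleton

end RNFAwtl

/-- A nondeterministic right one-way jumping finite automaton with input alphabet `α` and set of
states `Q`. -/
structure NROWJFA (α Q : Type*) where
  /-- the initial states -/
  init : Set Q
  /-- the final states -/
  final : Set Q
  /-- the transition relation -/
  step : Q → α → Set Q

namespace NROWJFA

variable {α Q : Type*}

/-- The letters that can be read in state `q`. -/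
def readable (J : NROWJFA α Q) (q : Q) : Set α := {a | (J.step q a).Nonempty}

/-- The right one-way jumping relation. A configuration is a pair of a state and the tape
contents (without the end-of-tape marker). -/
inductive Jump (J : NROWJFA α Q) : Q × List α → Q × List α → Prop where
  | jump (q q' : Q) (x y : List α) (a : α) (hx : ∀ b ∈ x, b ∉ J.readable q)
      (h : q' ∈ J.step q a) :
      Jump J (q, x ++ a :: y) (q', y ++ x)

/-- The language accepted by a right one-way jumping finite automaton. -/
def language (J : NROWJFA α Q) : Set (List α) :=
  {w | ∃ q₀ ∈ J.init, ∃ q ∈ J.final, Relation.ReflTransGen J.Jump (q₀, w) (q, [])}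

/-- `J` is deterministic, that is, an ROWJFA. -/
structure IsDeterministic (J : NROWJFA α Q) : Prop where
  init_eq : ∃ q₀, J.init = {q₀}
  step_subsingleton : ∀ q a, (J.step q a).Subsingleton

end NROWJFA

/-! Language classes. All letters are taken from a supply `Γ` of letters; an alphabet is a finite
subset `s` of `Γ`, and a word over `s` is regarded as a word over `Γ`. -/

/-- The class of all languages accepted by RDFAwtls. -/
def classRDFAwtl (Γ : Type*) : Set (Set (List Γ)) :=
  {L | ∃ (s : Finset Γ) (Q : Type) (_ : Finite Q) (A : RNFAwtl s Q),
    A.IsDeterministic ∧ L = List.map Subtype.val '' A.language}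

/-- The class of all languages accepted by NROWJFAs. -/
def classNROWJFA (Γ : Type*) : Set (Set (List Γ)) :=
  {L | ∃ (s : Finset Γ) (Q : Type) (_ : Finite Q) (J : NROWJFA s Q),
    L = List.map Subtype.val '' J.language}

/-- The class of all languages accepted by ROWJFAs. -/
def classROWJFA (Γ : Type*) : Set (Set (List Γ)) :=
  {L | ∃ (s : Finset Γ) (Q : Type) (_ : Finite Q) (J : NROWJFA s Q),
    J.IsDeterministic ∧ L = List.map Subtype.val '' J.language}

/-! Since `classROWJFA Γ ⊆ classNROWJFA Γ`, two non-inclusions give all four.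

An RDFAwtl outside `classNROWJFA`: `dyckAutomaton` accepts all `a ^ n * b ^ n`, and its accepted
words have as many `a` as `b` and never end in `a`. A jumping automaton with few states that accepts
`a ^ n * b ^ n` either reads the whole block of `a`s, which can then be pumped, or jumps over a rest
of it, which moves to the end of the tape. In the latter case a word ending in `a` is accepted too
(`exists_rotate_or_pump_mem_language`).

An ROWJFA outside `classRDFAwtl`: on long block words `c ^ n * a ^ m * b ^ l * a ^ k` a
deterministic translucent automaton deletes letters of the first three blocks in an order
independent of the block lengths (`exists_blockReach_or_end`). By pigeonhole its run loops.
Membership of `c ^ n * a ^ n * b ^ n * a ^ n` and the letter counts of accepted words force a loop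
to delete `t`, `2 * t`, `t` letters, so adding these letters to the first three blocks preserves
acceptance. But `balancedAutomaton` notices for `t ≥ 2`: once the last block is used up, it meets a
`c` where it needs an `a`. -/

open Relation

/-! ### Decompositions of words and right-unique relations -/

/-- Both decompositions cut the word at its first letter violating `p`. This is the source of
determinism in both models. -/
theorem List.append_cons_inj_of_forall {α : Type*} {p : α → Prop} {u u' v v' : List α} {a a' : α}
    (hu : ∀ x ∈ u, p x) (hu' : ∀ x ∈ u', p x) (ha : ¬ p a) (ha' : ¬ p a')
    (h : u ++ a :: v = u' ++ a' :: v') : u = u' ∧ a = a' ∧ v = v' := by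
  induction u generalizing u' with
  | nil =>
    cases u' with
    | nil => simpa using h
    | cons y u' =>
      simp only [List.nil_append, List.cons_append, List.cons.injEq] at h
      exact absurd (h.1 ▸ hu' y (by simp)) ha
  | cons x u ih =>
    cases u' with
    | nil =>
      simp only [List.nil_append, List.cons_append, List.cons.injEq] at h
      exact absurd (h.1 ▸ hu x (by simp)) ha'
    | cons y u' =>
      simp only [List.cons_append, List.cons.injEq] at h
      obtain ⟨h1, h2, h3⟩ := ih (fun z hz => hu z (by simp [hz])) (fun z hz => hu' z (by simp [hz])) h.2
      exact ⟨by rw [h.1, h1], h2, h3⟩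

section RightUnique

variable {β : Type*} {r : β → β → Prop} {x y z : β}

theorem Relation.ReflTransGen.of_rightUnique_of_terminal (hr : Relator.RightUnique r)
    (hz : ∀ d, ¬ r z d) (hxy : ReflTransGen r x y) (hxz : ReflTransGen r x z) :
    ReflTransGen r y z := by
  rcases ReflTransGen.total_of_right_unique hr hxy hxz with h | h
  · exact h
  · rcases h.cases_head with h | ⟨d, hd, -⟩
    · rw [h]
    · exact absurd hd (hz d)

theorem Relation.TransGen.not_reflTransGen_terminal (hr : Relator.RightUnique r)
    (hz : ∀ d, ¬ r z d) (hx : TransGen r x x) : ¬ ReflTransGen r x z := by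
  intro h
  -- By right-uniqueness the run from `x` never leaves its cycle, so whatever it reaches leads back
  -- to `x`.
  have key : ReflTransGen r z x := by
    clear hz
    induction h with
    | refl => exact .refl
    | tail _ hde ih =>
      rcases ih.cases_head with rfl | ⟨y, hy, hyx⟩
      · obtain ⟨y, hy, hyx⟩ := TransGen.head'_iff.1 hx
        exact hr hde hy ▸ hyx
      · exact hr hde hy ▸ hyx
  rcases reflTransGen_iff_eq_or_transGen.1 key with h1 | h1
  · obtain ⟨d, hd, -⟩ := TransGen.head'_iff.1 hx
    exact hz d (h1 ▸ hd)
  · obtain ⟨d, hd, -⟩ := TransGen.head'_iff.1 h1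
    exact hz d hd

end RightUnique

/-! ### The Dyck language -/

section Dyck

variable {α : Type*}

/-- The repetitive automaton that repeatedly deletes the first letter, which has to be `a`, and
then the first occurrence of `b`. -/
def dyckAutomaton (a b : α) (hab : a ≠ b) : RNFAwtl α Bool where
  transl q := {x | q = true ∧ x = a}
  init := {false}
  step q x := {q' | (q = false ∧ x = a ∧ q' = true) ∨ (q = true ∧ x = b ∧ q' = false)}
  stepEnd q := if q then .goto ∅ else .accept
  step_eq_empty := by
    rintro q x ⟨rfl, rfl⟩
    simp [hab]

theorem dyckAutomaton_isDeterministic (a b : α) (hab : a ≠ b) :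
    (dyckAutomaton a b hab).IsDeterministic where
  init_eq := ⟨false, rfl⟩
  step_subsingleton := by
    rintro (_ | _) x q hq q' hq' <;> simp_all [dyckAutomaton]
  stepEnd_subsingleton := by
    rintro (_ | _) S h
    · simp [dyckAutomaton] at h
    · simp only [dyckAutomaton, if_true, EndAction.goto.injEq] at h
      rw [← h]; exact Set.subsingleton_empty

theorem replicate_append_replicate_mem_dyck (a b : α) (hab : a ≠ b) (n : ℕ) :
    List.replicate n a ++ List.replicate n b ∈ (dyckAutomaton a b hab).language := by
  refine ⟨false, rfl, ?_⟩
  induction n with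
  | zero => exact .single (.endAccept _ _ (by simp) (by simp [dyckAutomaton]))
  | succ n ih =>
    refine .head (.read false true [] (List.replicate n a ++ List.replicate (n + 1) b) a (by simp)
      (by simp [dyckAutomaton]) (by simp [dyckAutomaton])) ?_
    refine .head (.read true false (List.replicate n a) (List.replicate n b) b
      (by simp [dyckAutomaton]) (by simp [dyckAutomaton, hab.symm]) (by simp [dyckAutomaton])) ih

theorem count_eq_and_getLast?_ne_of_mem_dyck [DecidableEq α] (a b : α) (hab : a ≠ b) (w : List α)
    (hw : w ∈ (dyckAutomaton a b hab).language) :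
    w.count a = w.count b ∧ w.getLast? ≠ some a := by
  -- An invariant of the configurations leading to acceptance, propagated backwards; in state `true`
  -- one extra `b` is owed.
  let P : RNFAwtl.Config α Bool → Prop
    | .run q w => w.count a + q.toNat = w.count b ∧ w.getLast? ≠ some a
    | .accept => True
    | .reject => False
  obtain ⟨q, rfl, h⟩ := hw
  suffices ∀ c, ReflTransGen (dyckAutomaton a b hab).Step c .accept → P c by
    simpa [P] using this _ h
  intro c hc
  induction hc using ReflTransGen.head_induction_on with
  | refl => trivial
  | head hstep _ ih =>
    cases hstep with
    | read q q' u v x hu hx h =>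
      simp only [P] at ih ⊢
      rcases h with ⟨rfl, rfl, rfl⟩ | ⟨rfl, rfl, rfl⟩
      · obtain rfl : u = [] := List.eq_nil_iff_forall_not_mem.2 fun y hy => by
          simpa [dyckAutomaton] using hu y hy
        cases v with
        -- A lone `a` would leave an empty tape with a `b` still owed.
        | nil => simp at ih
        | cons y v => simp_all [List.count_cons]
      · cases v with
        | nil => simp_all [List.count_append, hab.symm]
        | cons y v => simp_all [List.count_cons, List.count_append, hab.symm]; omega
    | stuck => exact ih.elim
    | endAccept q w hw h =>
      cases q
      · obtain rfl : w = [] := List.eq_nil_iff_forall_not_mem.2 fun y hy => by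
          simpa [dyckAutomaton] using hw y hy
        simp [P]
      · simp [dyckAutomaton] at h
    | endReject => exact ih.elim
    | endGoto q q' w S hw h hq' =>
      cases q
      · simp [dyckAutomaton] at h
      · simp only [dyckAutomaton, if_true, EndAction.goto.injEq] at h
        simp [← h] at hq'

end Dyck

/-! ### Right one-way jumping automata do not accept the Dyck language -/

namespace NROWJFA

variable {α Q : Type*} (J : NROWJFA α Q)

/-- A final configuration is reachable. -/
def Accepts (q : Q) (w : List α) : Prop := ∃ p ∈ J.final, ReflTransGen J.Jump (q, w) (p, [])

variable {J}

theorem Accepts.of_jump {q q' : Q} {w w' : List α} (h : J.Jump (q, w) (q', w'))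
    (h' : J.Accepts q' w') : J.Accepts q w :=
  let ⟨p, hp, hr⟩ := h'
  ⟨p, hp, .head h hr⟩

theorem Accepts.cons {q q' : Q} {w : List α} {a : α} (h : q' ∈ J.step q a)
    (h' : J.Accepts q' w) : J.Accepts q (a :: w) :=
  h'.of_jump (by simpa using Jump.jump (J := J) q q' [] w a (by simp) h)

theorem Accepts.replicate_append {p : ℕ → Q} {a : α} {w : List α} {i d : ℕ}
    (hp : ∀ j < d, p (i + j + 1) ∈ J.step (p (i + j)) a) (h : J.Accepts (p (i + d)) w) :
    J.Accepts (p i) (List.replicate d a ++ w) := by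
  induction d generalizing i with
  | zero => exact h
  | succ d ih =>
    refine Accepts.cons (hp 0 (by omega)) (ih (fun j hj => ?_) ?_)
    · have := hp (j + 1) (by omega)
      rwa [show i + 0 + 1 + j = i + (j + 1) by ring]
    · rwa [show i + 0 + 1 + d = i + (d + 1) by ring]

/-- Either the initial block of letters `a` is read letter by letter, or the remainder of this
block may be moved to the end of the word. -/
theorem Accepts.exists_path_or_exists_rotate {a b : α} {m n : ℕ} {q : Q}
    (h : J.Accepts q (List.replicate n a ++ List.replicate m b)) :
    (∃ p : ℕ → Q, p 0 = q ∧ (∀ i < n, p (i + 1) ∈ J.step (p i) a) ∧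
      J.Accepts (p n) (List.replicate m b)) ∨
    ∃ k < n, J.Accepts q
      (List.replicate k a ++ List.replicate m b ++ List.replicate (n - k) a) := by
  induction n generalizing q with
  | zero => exact .inl ⟨fun _ => q, rfl, by simp, by simpa using h⟩
  | succ n ih =>
    obtain ⟨f, hf, hr⟩ := h
    rcases hr.cases_head with h0 | ⟨⟨q', w'⟩, hjump, hr⟩
    · simp at h0
    have hacc : J.Accepts q' w' := ⟨f, hf, hr⟩
    generalize hw : List.replicate (n + 1) a ++ List.replicate m b = w at hjump
    cases hjump with
    | jump _ _ x y l hx hl =>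
      by_cases ha : a ∈ J.readable q
      · cases x with
        | nil =>
          simp only [List.replicate_succ, List.cons_append, List.nil_append,
            List.cons.injEq] at hw
          obtain ⟨rfl, rfl⟩ := hw
          rw [List.append_nil] at hacc
          rcases ih hacc with ⟨p, hp0, hp, hpn⟩ | ⟨k, hk, hkacc⟩
          · refine .inl ⟨fun i => i.casesOn q p, rfl, fun i hi => ?_, hpn⟩
            cases i with
            | zero => simpa [hp0] using hl
            | succ i => exact hp i (by omega)
          · refine .inr ⟨k + 1, by omega, ?_⟩
            simpa [List.replicate_succ] using Accepts.cons hl hkacc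
        | cons c x =>
          simp only [List.replicate_succ, List.cons_append, List.cons.injEq] at hw
          exact absurd (hw.1 ▸ ha) (hx c (by simp))
      · have hla : l ∈ J.readable q := ⟨_, hl⟩
        cases m with
        | zero =>
          have : l ∈ List.replicate (n + 1) a ++ List.replicate 0 b := by rw [hw]; simp
          simp only [List.replicate_zero, List.append_nil, List.mem_replicate] at this
          exact absurd (this.2 ▸ hla) ha
        | succ m =>
          by_cases hb : b ∈ J.readable q
          · obtain ⟨rfl, rfl, rfl⟩ := List.append_cons_inj_of_forall
              (p := fun c => c ∉ J.readable q) (by simpa using ha) hx (by simpa using hb)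
              (by simpa using hla) hw
            -- Jumping over the `a`s and reading the first `b` yields the same configuration as
            -- reading that `b` with the `a`s already at the end.
            refine .inr ⟨0, by omega, ?_⟩
            simpa [List.replicate_succ] using Accepts.cons hl hacc
          · have : l ∈ List.replicate (n + 1) a ++ List.replicate (m + 1) b := by rw [hw]; simp
            simp only [List.mem_append, List.mem_replicate] at this
            rcases this with h | h
            · exact absurd (h.2 ▸ hla) ha
            · exact absurd (h.2 ▸ hla) hb

/-- Reading `Fintype.card Q` letters `a` one by one visits some state twice, and the segment between
the two visits can be repeated. -/
theorem exists_rotate_or_pump_mem_language [Finite Q] (J : NROWJFA α Q) {a b : α}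
    (h : ∀ n, List.replicate n a ++ List.replicate n b ∈ J.language) :
    ∃ n, (∃ k < n, List.replicate k a ++ List.replicate n b ++ List.replicate (n - k) a ∈
        J.language) ∨
      ∃ d > 0, List.replicate (n + d) a ++ List.replicate n b ∈ J.language := by
  have := Fintype.ofFinite Q
  refine ⟨Fintype.card Q, ?_⟩
  obtain ⟨q, hq, hacc⟩ := h (Fintype.card Q)
  rcases Accepts.exists_path_or_exists_rotate hacc with ⟨p, rfl, hp, hpn⟩ | ⟨k, hk, hkacc⟩
  · right
    obtain ⟨i', j', hne, heq⟩ := Fintype.exists_ne_map_eq_of_card_lt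
      (fun i : Fin (Fintype.card Q + 1) => p i) (by simp)
    obtain ⟨i, j, hij, hj, heq⟩ : ∃ i j : ℕ, i < j ∧ j ≤ Fintype.card Q ∧ p i = p j := by
      rcases lt_or_gt_of_ne hne with h | h
      · exact ⟨i', j', h, by omega, heq⟩
      · exact ⟨j', i', h, by omega, heq.symm⟩
    refine ⟨j - i, by omega, p 0, hq, ?_⟩
    -- Since `p i = p j`, the letters after position `i` may be read following the first `j` ones,
    -- which adds `j - i` letters `a`.
    have h1 : J.Accepts (p i)
        (List.replicate (Fintype.card Q - i) a ++ List.replicate (Fintype.card Q) b) :=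
      Accepts.replicate_append (fun t ht => hp _ (by omega))
        (by rwa [show i + (Fintype.card Q - i) = Fintype.card Q by omega])
    have h2 := Accepts.replicate_append (i := 0) (d := j) (fun t ht => hp _ (by omega))
      (by rwa [zero_add, ← heq])
    rwa [← List.append_assoc, List.replicate_append_replicate,
      show j + (Fintype.card Q - i) = Fintype.card Q + (j - i) by omega] at h2
  · exact .inl ⟨k, hk, q, hq, hkacc⟩

end NROWJFA

/-! ### A language of a right one-way jumping automaton with balanced blocks -/

/-- The word `c ^ n * a ^ m * b ^ l * a ^ k`. -/
def blockWord {α : Type*} (c a b : α) (n m l k : ℕ) : List α :=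
  List.replicate n c ++ (List.replicate m a ++ (List.replicate l b ++ List.replicate k a))

section Balanced

variable {α : Type*} {c a b : α}

/-- The right one-way jumping automaton that reads, in this cyclic order, letters `c`, `a`, `b`,
`a`, and that enters the dead state `4` if a `c` is met when the second `a` is looked for. -/
def balancedAutomaton (c a b : α) : NROWJFA α (Fin 5) where
  init := {0}
  final := {0}
  step q x := {q' | (q = 0 ∧ x = c ∧ q' = 1) ∨ (q = 1 ∧ x = a ∧ q' = 2) ∨
    (q = 2 ∧ x = b ∧ q' = 3) ∨ (q = 3 ∧ x = a ∧ q' = 0) ∨ (q = 3 ∧ x = c ∧ q' = 4)}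

theorem mem_step_balancedAutomaton {q q' : Fin 5} {x : α} :
    q' ∈ (balancedAutomaton c a b).step q x ↔
      (q = 0 ∧ x = c ∧ q' = 1) ∨ (q = 1 ∧ x = a ∧ q' = 2) ∨
      (q = 2 ∧ x = b ∧ q' = 3) ∨ (q = 3 ∧ x = a ∧ q' = 0) ∨ (q = 3 ∧ x = c ∧ q' = 4) := Iff.rfl

theorem mem_readable_balancedAutomaton {q : Fin 5} {x : α} :
    x ∈ (balancedAutomaton c a b).readable q ↔
      (q = 0 ∧ x = c) ∨ (q = 1 ∧ x = a) ∨ (q = 2 ∧ x = b) ∨ (q = 3 ∧ (x = a ∨ x = c)) := by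
  simp only [NROWJFA.readable, Set.mem_ofPred_eq, Set.Nonempty, mem_step_balancedAutomaton]
  constructor
  · rintro ⟨q', h⟩
    tauto
  · rintro (h | h | h | ⟨h, h' | h'⟩)
    · exact ⟨1, by tauto⟩
    · exact ⟨2, by tauto⟩
    · exact ⟨3, by tauto⟩
    · exact ⟨0, by tauto⟩
    · exact ⟨4, by tauto⟩

theorem balancedAutomaton_isDeterministic (hca : c ≠ a) :
    (balancedAutomaton c a b).IsDeterministic where
  init_eq := ⟨0, rfl⟩
  step_subsingleton := by
    intro q x q₁ h₁ q₂ h₂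
    have hac := hca.symm
    rw [mem_step_balancedAutomaton] at h₁ h₂
    rcases h₁ with ⟨rfl, rfl, rfl⟩ | ⟨rfl, rfl, rfl⟩ | ⟨rfl, rfl, rfl⟩ | ⟨rfl, rfl, rfl⟩ |
      ⟨rfl, rfl, rfl⟩ <;> simp_all

theorem NROWJFA.IsDeterministic.rightUnique_jump {Q : Type*} {J : NROWJFA α Q}
    (hJ : J.IsDeterministic) : Relator.RightUnique J.Jump := by
  intro s t t' h h'
  cases h with
  | jump q q₁ x y l hx hl =>
    generalize hw : x ++ l :: y = w at h'
    cases h' with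
    | jump _ q₂ x' y' l' hx' hl' =>
      obtain ⟨rfl, rfl, rfl⟩ := List.append_cons_inj_of_forall
        (p := fun d => d ∉ J.readable q) hx hx' (by simpa using ⟨q₁, hl⟩)
        (by simpa using ⟨q₂, hl'⟩) hw
      rw [hJ.step_subsingleton _ _ hl hl']

theorem count_of_mem_balanced [DecidableEq α] (hca : c ≠ a) (hcb : c ≠ b) (hab : a ≠ b) {w : List α}
    (hw : w ∈ (balancedAutomaton c a b).language) :
    w.count a = 2 * w.count c ∧ w.count b = w.count c := by
  -- The state tells which letters of the current cycle are still owed. State `4` is absent because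
  -- nothing is accepted from it.
  let P : Fin 5 × List α → Prop := fun s =>
    (s.1 = 0 ∧ s.2.count a = 2 * s.2.count c ∧ s.2.count b = s.2.count c) ∨
    (s.1 = 1 ∧ s.2.count a = 2 * s.2.count c + 2 ∧ s.2.count b = s.2.count c + 1) ∨
    (s.1 = 2 ∧ s.2.count a = 2 * s.2.count c + 1 ∧ s.2.count b = s.2.count c + 1) ∨
    (s.1 = 3 ∧ s.2.count a = 2 * s.2.count c + 1 ∧ s.2.count b = s.2.count c)
  obtain ⟨q, rfl, q', rfl, h⟩ := hw
  suffices ∀ s, ReflTransGen (balancedAutomaton c a b).Jump s (0, []) → P s by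
    simpa [P] using this _ h
  intro s hs
  induction hs using ReflTransGen.head_induction_on with
  | refl => simp [P]
  | head hstep _ ih =>
    cases hstep with
    | jump q q' x y l hx hl =>
      rw [mem_step_balancedAutomaton] at hl
      rcases hl with ⟨rfl, rfl, rfl⟩ | ⟨rfl, rfl, rfl⟩ | ⟨rfl, rfl, rfl⟩ | ⟨rfl, rfl, rfl⟩ |
        ⟨rfl, rfl, rfl⟩ <;>
      simp [P, List.count_append, hca, hcb, hab, hca.symm, hcb.symm,
        hab.symm] at ih ⊢ <;> omega

/-- In a sweep over a block word whose first `c` has been read, an `a` and a `b` are read next. -/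
theorem balancedAutomaton_reach_three (hca : c ≠ a) (hab : a ≠ b) (n m l k : ℕ) :
    ReflTransGen (balancedAutomaton c a b).Jump
      (1, blockWord c a b n (m + 1) (l + 1) k)
      (3, List.replicate l b ++ (List.replicate k a ++ (List.replicate n c ++
        List.replicate m a))) := by
  refine .head (b := (2, List.replicate m a ++ (List.replicate (l + 1) b ++ List.replicate k a) ++
    List.replicate n c)) ?_ (.single ?_)
  · exact .jump 1 2 (List.replicate n c) _ a
      (by simp [mem_readable_balancedAutomaton, hca]) (by simp [mem_step_balancedAutomaton])
  · have := NROWJFA.Jump.jump (J := balancedAutomaton c a b) 2 3 (List.replicate m a)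
      (List.replicate l b ++ List.replicate k a ++ List.replicate n c) b
      (by simp [mem_readable_balancedAutomaton, hab]) (by simp [mem_step_balancedAutomaton])
    simpa [List.replicate_succ] using this

/-- As the last block is nonempty, the second `a` is found there, before any `c`. Each of the three
remaining letters of the cycle is taken from its own block. -/
theorem balancedAutomaton_reach_zero (hca : c ≠ a) (hcb : c ≠ b) (hab : a ≠ b) (n m l k : ℕ) :
    ReflTransGen (balancedAutomaton c a b).Jump
      (1, blockWord c a b n (m + 1) (l + 1) (k + 1))
      (0, List.replicate k a ++ (List.replicate n c ++
        (List.replicate m a ++ List.replicate l b))) := by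
  refine .tail (balancedAutomaton_reach_three hca hab n m l (k + 1)) ?_
  have := NROWJFA.Jump.jump (J := balancedAutomaton c a b) 3 0 (List.replicate l b)
      (List.replicate k a ++ (List.replicate n c ++ List.replicate m a)) a
      (by simp [mem_readable_balancedAutomaton, hab.symm, hcb.symm])
      (by simp [mem_step_balancedAutomaton])
  simpa [List.replicate_succ] using this

theorem balancedAutomaton_jump_one (n m l k : ℕ) :
    (balancedAutomaton c a b).Jump (0, blockWord c a b (n + 1) m l k)
      (1, blockWord c a b n m l k) := by
  have := NROWJFA.Jump.jump (J := balancedAutomaton c a b) 0 1 []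
      (blockWord c a b n m l k) c (by simp) (by simp [mem_step_balancedAutomaton])
  simpa [blockWord, List.replicate_succ] using this

theorem balancedAutomaton_jump_one' (hca : c ≠ a) (n m l k : ℕ) :
    (balancedAutomaton c a b).Jump
      (0, List.replicate k a ++ (List.replicate (n + 1) c ++
        (List.replicate m a ++ List.replicate l b)))
      (1, blockWord c a b n m l k) := by
  have := NROWJFA.Jump.jump (J := balancedAutomaton c a b) 0 1 (List.replicate k a)
      (List.replicate n c ++ (List.replicate m a ++ List.replicate l b)) c
      (by simp [mem_readable_balancedAutomaton, hca.symm]) (by simp [mem_step_balancedAutomaton])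
  simpa [blockWord, List.replicate_succ] using this

/-- Each cycle takes one letter from each of the four blocks and restores their rotated arrangement,
until the block of `k` letters is exhausted. -/
theorem balancedAutomaton_reach_sub (hca : c ≠ a) (hcb : c ≠ b) (hab : a ≠ b) (n m l k : ℕ) :
    ReflTransGen (balancedAutomaton c a b).Jump
      (0, List.replicate k a ++ (List.replicate (n + k) c ++
        (List.replicate (m + k) a ++ List.replicate (l + k) b)))
      (0, List.replicate n c ++ (List.replicate m a ++ List.replicate l b)) := by
  induction k with
  | zero => exact .refl
  | succ k ih =>
    exact (ReflTransGen.head (balancedAutomaton_jump_one' hca _ _ _ _)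
      (balancedAutomaton_reach_zero hca hcb hab (n + k) (m + k) (l + k) k)).trans ih

theorem balancedAutomaton_reach_sub' (hca : c ≠ a) (hcb : c ≠ b) (hab : a ≠ b) (n m l k : ℕ) :
    ReflTransGen (balancedAutomaton c a b).Jump
      (0, blockWord c a b (n + k) (m + k) (l + k) k)
      (0, List.replicate n c ++ (List.replicate m a ++ List.replicate l b)) := by
  cases k with
  | zero => simpa [blockWord] using ReflTransGen.refl
  | succ k =>
    exact (ReflTransGen.head (balancedAutomaton_jump_one _ _ _ _)
      (balancedAutomaton_reach_zero hca hcb hab (n + k) (m + k) (l + k) k)).trans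
      (balancedAutomaton_reach_sub hca hcb hab n m l k)

theorem blockWord_mem_balanced (hca : c ≠ a) (hcb : c ≠ b) (hab : a ≠ b) (n : ℕ) :
    blockWord c a b n n n n ∈ (balancedAutomaton c a b).language := by
  refine ⟨0, rfl, 0, rfl, ?_⟩
  simpa using balancedAutomaton_reach_sub' hca hcb hab 0 0 0 n

open Classical in
theorem eq_of_blockWord_mem_balanced (hca : c ≠ a) (hcb : c ≠ b) (hab : a ≠ b) {n m l k : ℕ}
    (h : blockWord c a b n m l k ∈ (balancedAutomaton c a b).language) :
    m + k = 2 * n ∧ l = n := by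
  have := count_of_mem_balanced hca hcb hab h
  simpa [blockWord, List.count_append, List.count_replicate, hca, hcb, hab, hca.symm, hcb.symm,
    hab.symm] using this

/-- The letter counts are right, so the order must matter: after `k` cycles `c ^ (t + 2) * a ^ (2 *
(t + 2)) * b ^ (t + 2)` is left. In the next cycle the search for the second `a` passes the `b`s and
wraps around to the front, where a second `c` is still present. -/
theorem blockWord_notMem_balanced (hca : c ≠ a) (hcb : c ≠ b) (hab : a ≠ b) (t k : ℕ) :
    blockWord c a b (t + 2 + k) (2 * (t + 2) + k) (t + 2 + k) k ∉
      (balancedAutomaton c a b).language := by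
  rintro ⟨q, rfl, q', rfl, h⟩
  have h1 := balancedAutomaton_reach_sub' hca hcb hab (t + 2) (2 * (t + 2)) (t + 2) k
  have h2 := h1.trans (.head (balancedAutomaton_jump_one' hca (t + 1) (2 * (t + 2)) (t + 2) 0)
    (balancedAutomaton_reach_three hca hab (t + 1) (2 * t + 3) (t + 1) 0))
  have h3 := h2.tail (NROWJFA.Jump.jump (J := balancedAutomaton c a b) 3 4
    (List.replicate (t + 1) b) (List.replicate t c ++ List.replicate (2 * t + 3) a) c
      (by simp [mem_readable_balancedAutomaton, hab.symm, hcb.symm])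
      (by simp [mem_step_balancedAutomaton]))
  -- By determinism an accepting run would have to continue from the dead state.
  have h4 := ReflTransGen.of_rightUnique_of_terminal
    (balancedAutomaton_isDeterministic hca).rightUnique_jump
    (by
      intro d hd
      generalize hw : ([] : List α) = w at hd
      cases hd
      simp at hw) h3 h
  have hdead : ∀ w d, ¬ (balancedAutomaton c a b).Jump (4, w) d := by
    intro w d hd
    cases hd with
    | jump _ _ _ _ _ _ hl => simp [mem_step_balancedAutomaton] at hl
  rcases h4.cases_head with h5 | ⟨d, hd, -⟩
  · simp at h5
  · exact hdead _ _ hd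

end Balanced

/-! ### Deterministic repetitive automata do not accept the balanced language -/

namespace RNFAwtl

variable {α Q : Type*} {A : RNFAwtl α Q}

theorem IsDeterministic.rightUnique_step (hA : A.IsDeterministic) :
    Relator.RightUnique A.Step := by
  have hread : ∀ {q : Q} {u v w : List α} {x : α}, x ∉ A.transl q → w = u ++ x :: v →
      ¬ ∀ y ∈ w, y ∈ A.transl q := fun hx hw h => hx (h _ (by simp [hw]))
  intro s t t' h h'
  cases h with
  | read q q₁ u v x hu hx hq =>
    generalize hw : u ++ x :: v = w at h'
    cases h' with
    | read _ q₂ u' v' x' hu' hx' hq' =>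
      obtain ⟨rfl, rfl, rfl⟩ := List.append_cons_inj_of_forall (p := (· ∈ A.transl q))
        hu hu' hx hx' hw
      rw [hA.step_subsingleton _ _ hq hq']
    | stuck _ u' v' x' hu' hx' hq' =>
      obtain ⟨rfl, rfl, rfl⟩ := List.append_cons_inj_of_forall (p := (· ∈ A.transl q))
        hu hu' hx hx' hw
      simp [hq'] at hq
    | endAccept _ _ hw' => exact absurd hw' (hread hx hw.symm)
    | endReject _ _ hw' => exact absurd hw' (hread hx hw.symm)
    | endGoto _ _ _ _ hw' => exact absurd hw' (hread hx hw.symm)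
  | stuck q u v x hu hx hq =>
    generalize hw : u ++ x :: v = w at h'
    cases h' with
    | read _ q₂ u' v' x' hu' hx' hq' =>
      obtain ⟨rfl, rfl, rfl⟩ := List.append_cons_inj_of_forall (p := (· ∈ A.transl q))
        hu hu' hx hx' hw
      simp [hq] at hq'
    | stuck => rfl
    | endAccept _ _ hw' => exact absurd hw' (hread hx hw.symm)
    | endReject _ _ hw' => rfl
    | endGoto _ _ _ _ hw' => exact absurd hw' (hread hx hw.symm)
  | endAccept q w hw h =>
    cases h' with
    | read _ _ _ _ _ _ hx => exact absurd hw (hread hx rfl)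
    | stuck _ _ _ _ _ hx => exact absurd hw (hread hx rfl)
    | endAccept => rfl
    | endReject _ _ _ h' => simp [h] at h'
    | endGoto _ _ _ _ _ h' => simp [h] at h'
  | endReject q w hw h =>
    cases h' with
    | read _ _ _ _ _ _ hx => exact absurd hw (hread hx rfl)
    | stuck _ _ _ _ _ hx => rfl
    | endAccept _ _ _ h' => simp [h] at h'
    | endReject => rfl
    | endGoto _ _ _ _ _ h' hq' =>
      rw [h, EndAction.goto.injEq] at h'
      simp [← h'] at hq'
  | endGoto q q₁ w S hw h hq =>
    cases h' with
    | read _ _ _ _ _ _ hx => exact absurd hw (hread hx rfl)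
    | stuck _ _ _ _ _ hx => exact absurd hw (hread hx rfl)
    | endAccept _ _ _ h' => simp [h] at h'
    | endReject _ _ _ h' =>
      rw [h, EndAction.goto.injEq] at h'
      simp [h'] at hq
    | endGoto _ q₂ _ _ _ h' hq' =>
      rw [h, EndAction.goto.injEq] at h'
      subst h'
      rw [hA.stepEnd_subsingleton _ _ h hq hq']

theorem not_step_accept (A : RNFAwtl α Q) (s : Config α Q) : ¬ A.Step .accept s := nofun

theorem not_reflTransGen_reject_accept (A : RNFAwtl α Q) :
    ¬ ReflTransGen A.Step .reject .accept := by
  intro h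
  rcases h.cases_head with h | ⟨d, hd, -⟩
  · cases h
  · cases hd

/-- From state `p.1` to state `p'.1`, where the other components count the letters that have been
deleted from the first three blocks of a block word, whatever the lengths of the blocks are. -/
def BlockReach (A : RNFAwtl α Q) (c a b : α) (p p' : Q × ℕ × ℕ × ℕ) : Prop :=
  p.2.1 ≤ p'.2.1 ∧ p.2.2.1 ≤ p'.2.2.1 ∧ p.2.2.2 ≤ p'.2.2.2 ∧
  ∀ n m l k, p'.2.1 < n → p'.2.2.1 < m → p'.2.2.2 < l →
    TransGen A.Step
      (.run p.1 (blockWord c a b (n - p.2.1) (m - p.2.2.1) (l - p.2.2.2) k))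
      (.run p'.1 (blockWord c a b (n - p'.2.1) (m - p'.2.2.1) (l - p'.2.2.2) k))

theorem BlockReach.trans {c a b : α} {p p' p'' : Q × ℕ × ℕ × ℕ} (h : A.BlockReach c a b p p')
    (h' : A.BlockReach c a b p' p'') : A.BlockReach c a b p p'' :=
  ⟨h.1.trans h'.1, h.2.1.trans h'.2.1, h.2.2.1.trans h'.2.2.1, fun n m l k hn hm hl =>
    (h.2.2.2 n m l k (h'.1.trans_lt hn) (h'.2.1.trans_lt hm) (h'.2.2.1.trans_lt hl)).trans
      (h'.2.2.2 n m l k hn hm hl)⟩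

/-- Lets `Nat.rel_of_forall_rel_succ_of_lt` chain the successive moves of the run. -/
instance (c a b : α) : IsTrans _ (A.BlockReach c a b) := ⟨fun _ _ _ => BlockReach.trans⟩

/-- A state either reads a letter of the first three blocks, whatever the lengths of the blocks
are, or treats all block words as words of translucent letters. -/
theorem exists_blockReach_or_end (c a b : α) (q : Q) (x y z : ℕ) :
    (∃ q' x' y' z', A.BlockReach c a b (q, x, y, z) (q', x', y', z')) ∨
    (∀ n m l k, 0 < n → 0 < m → 0 < l →
      A.Step (.run q (blockWord c a b n m l k)) .reject) ∨
    (∀ n m l k, 0 < n → 0 < m → 0 < l →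
      A.Step (.run q (blockWord c a b n m l k)) .accept) := by
  -- The first of `c`, `a`, `b` that is not translucent decides the move. The fourth block stays
  -- invisible as long as the second is nonempty.
  by_cases hc : c ∈ A.transl q
  swap
  · rcases (A.step q c).eq_empty_or_nonempty with h | ⟨q', h⟩
    · refine .inr (.inl fun n m l k hn hm hl => ?_)
      obtain ⟨n, rfl⟩ := Nat.exists_eq_add_of_lt hn
      simpa [blockWord, List.replicate_succ] using
        Step.stuck (A := A) q [] (blockWord c a b n m l k) c (by simp) hc h
    · refine .inl ⟨q', x + 1, y, z, by simp, le_rfl, le_rfl, fun n m l k hn hm hl => .single ?_⟩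
      obtain ⟨n, rfl⟩ := Nat.exists_eq_add_of_lt hn
      have := Step.read (A := A) q q' [] (blockWord c a b (n + 1) (m - y) (l - z) k) c
        (by simp) hc h
      simp only [show x + 1 + n + 1 - x = n + 1 + 1 by omega,
        show x + 1 + n + 1 - (x + 1) = n + 1 by omega]
      simpa [blockWord, List.replicate_succ] using this
  by_cases ha : a ∈ A.transl q
  swap
  · rcases (A.step q a).eq_empty_or_nonempty with h | ⟨q', h⟩
    · refine .inr (.inl fun n m l k hn hm hl => ?_)
      obtain ⟨m, rfl⟩ := Nat.exists_eq_add_of_lt hm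
      simpa [blockWord, List.replicate_succ] using
        Step.stuck (A := A) q (List.replicate n c)
          (List.replicate m a ++ (List.replicate l b ++ List.replicate k a)) a
          (by simp [hc]) ha h
    · refine .inl ⟨q', x, y + 1, z, le_rfl, by simp, le_rfl, fun n m l k hn hm hl => .single ?_⟩
      obtain ⟨m, rfl⟩ := Nat.exists_eq_add_of_lt hm
      have := Step.read (A := A) q q' (List.replicate (n - x) c)
        (List.replicate (m + 1) a ++ (List.replicate (l - z) b ++ List.replicate k a)) a
        (by simp [hc]) ha h
      simp only [show y + 1 + m + 1 - y = m + 1 + 1 by omega,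
        show y + 1 + m + 1 - (y + 1) = m + 1 by omega]
      simpa [blockWord, List.replicate_succ] using this
  by_cases hb : b ∈ A.transl q
  swap
  · rcases (A.step q b).eq_empty_or_nonempty with h | ⟨q', h⟩
    · refine .inr (.inl fun n m l k hn hm hl => ?_)
      obtain ⟨l, rfl⟩ := Nat.exists_eq_add_of_lt hl
      simpa [blockWord, List.replicate_succ] using
        Step.stuck (A := A) q (List.replicate n c ++ List.replicate m a)
          (List.replicate l b ++ List.replicate k a) b
          (by simp only [List.mem_append, List.mem_replicate]; rintro d (h | h) <;> simp_all)
          hb h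
    · refine .inl ⟨q', x, y, z + 1, le_rfl, le_rfl, by simp, fun n m l k hn hm hl => .single ?_⟩
      obtain ⟨l, rfl⟩ := Nat.exists_eq_add_of_lt hl
      have := Step.read (A := A) q q' (List.replicate (n - x) c ++ List.replicate (m - y) a)
        (List.replicate (l + 1) b ++ List.replicate k a) b
        (by simp only [List.mem_append, List.mem_replicate]; rintro d (h | h) <;> simp_all)
        hb h
      simp only [show z + 1 + l + 1 - z = l + 1 + 1 by omega,
        show z + 1 + l + 1 - (z + 1) = l + 1 by omega]
      simpa [blockWord, List.replicate_succ] using this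
  have hw : ∀ n m l k, ∀ d ∈ blockWord c a b n m l k, d ∈ A.transl q := by
    intro n m l k d hd
    simp only [blockWord, List.mem_append, List.mem_replicate] at hd
    rcases hd with h | h | h | h <;> rw [h.2] <;> assumption
  cases hend : A.stepEnd q with
  | accept => exact .inr (.inr fun n m l k _ _ _ => .endAccept _ _ (hw n m l k) hend)
  | goto S =>
    rcases S.eq_empty_or_nonempty with rfl | ⟨q', hq'⟩
    · exact .inr (.inl fun n m l k _ _ _ => .endReject _ _ (hw n m l k) hend)
    · exact .inl ⟨q', x, y, z, le_rfl, le_rfl, le_rfl, fun n m l k _ _ _ =>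
        .single (.endGoto _ _ _ _ (hw _ _ _ _) hend hq')⟩

theorem IsDeterministic.not_forall_blockWord [Finite Q] (hA : A.IsDeterministic) {c a b : α}
    (h₁ : ∀ n, blockWord c a b n n n n ∈ A.language)
    (h₂ : ∀ {n m l k}, blockWord c a b n m l k ∈ A.language → m + k = 2 * n ∧ l = n)
    (h₃ : ∀ t k, blockWord c a b (t + 2 + k) (2 * (t + 2) + k) (t + 2 + k) k ∉ A.language) :
    False := by
  obtain ⟨q₀, hq₀⟩ := hA.init_eq
  have hmem : ∀ w, w ∈ A.language ↔ ReflTransGen A.Step (.run q₀ w) .accept := by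
    simp [language, hq₀]
  simp only [hmem] at h₁ h₂ h₃
  have hr := hA.rightUnique_step
  have hacc : ∀ {s t}, ReflTransGen A.Step s t → ReflTransGen A.Step s .accept →
      ReflTransGen A.Step t .accept :=
    ReflTransGen.of_rightUnique_of_terminal hr A.not_step_accept
  -- The invariant along the infinite run on block words.
  let R := A.BlockReach c a b
  let p₀ : Q × ℕ × ℕ × ℕ := (q₀, 0, 0, 0)
  -- `R` demands at least one step, so the starting point is admitted separately.
  have hreach : ∀ {p}, p₀ = p ∨ R p₀ p → ∀ n m l k, p.2.1 < n → p.2.2.1 < m → p.2.2.2 < l →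
      ReflTransGen A.Step (.run q₀ (blockWord c a b n m l k))
        (.run p.1 (blockWord c a b (n - p.2.1) (m - p.2.2.1) (l - p.2.2.2) k)) := by
    rintro p (rfl | h) n m l k hn hm hl
    · exact .refl
    · exact (h.2.2.2 n m l k hn hm hl).to_reflTransGen
  -- The run never halts: rejection would hit some `blockWord c a b N N N N`, and acceptance would
  -- also accept `blockWord c a b (N + 1) N N N`, whose counts are wrong.
  have hnext : ∀ p, (p₀ = p ∨ R p₀ p) → ∃ p', R p p' := by
    rintro ⟨q, x, y, z⟩ hp
    rcases A.exists_blockReach_or_end c a b q x y z with ⟨q', x', y', z', h⟩ | h | h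
    · exact ⟨_, h⟩
    · let N := x + y + z + 1
      have h4 := (hreach hp N N N N (by simp only [N]; omega) (by simp only [N]; omega)
        (by simp only [N]; omega)).tail (h _ _ _ _ (by simp only [N]; omega)
        (by simp only [N]; omega) (by simp only [N]; omega))
      exact (A.not_reflTransGen_reject_accept (hacc h4 (h₁ N))).elim
    · let N := x + y + z + 1
      have h4 := (hreach hp (N + 1) N N N (by simp only [N]; omega) (by simp only [N]; omega)
        (by simp only [N]; omega)).tail (h _ _ _ _ (by simp only [N]; omega)
        (by simp only [N]; omega) (by simp only [N]; omega))
      have := h₂ h4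
      omega
  choose! f hf using hnext
  let p : ℕ → Q × ℕ × ℕ × ℕ := fun i => f^[i] p₀
  have hp₀ : ∀ i, p₀ = p i ∨ R p₀ (p i) := by
    intro i
    induction i with
    | zero => exact .inl rfl
    | succ i ih =>
      have h := hf _ ih
      simp only [p, Function.iterate_succ_apply'] at h ih ⊢
      rcases ih with h' | h'
      · rw [← h'] at h ⊢
        exact .inr h
      · exact .inr (h'.trans h)
  have hp : ∀ i j, i < j → R (p i) (p j) := fun i j hij =>
    Nat.rel_of_forall_rel_succ_of_lt R (fun i => by
      have := hf _ (hp₀ i)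
      simpa only [p, Function.iterate_succ_apply'] using this) hij
  -- A loop of this run deletes letters in the proportions `1 : 2 : 1`.
  have hloop : ∀ i j, i < j → (p i).1 = (p j).1 → ∃ N t, 0 < t ∧
      (p j).2.1 = (p i).2.1 + t ∧ (p j).2.2.1 = (p i).2.2.1 + 2 * t ∧
      (p j).2.2.2 = (p i).2.2.2 + t ∧
      ReflTransGen A.Step (.run q₀ (blockWord c a b (t + N) (2 * t + N) (t + N) N)) .accept := by
    intro i j hij heq
    have hRij := hp i j hij
    obtain ⟨hx, hy, hz, hstep⟩ := hRij
    have hi := hp₀ i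
    have hj := hp₀ j
    generalize p i = s at *
    generalize p j = s' at *
    obtain ⟨q, x, y, z⟩ := s
    obtain ⟨q', x', y', z'⟩ := s'
    simp only at hx hy hz heq hstep hi hj ⊢
    subst heq
    obtain ⟨x', rfl⟩ := Nat.exists_eq_add_of_le hx
    obtain ⟨y', rfl⟩ := Nat.exists_eq_add_of_le hy
    obtain ⟨z', rfl⟩ := Nat.exists_eq_add_of_le hz
    -- Large enough that no block is used up before the end of the loop.
    let N := x + x' + y + y' + z + z' + 1
    have hi' := hacc (hreach hi N N N N (by simp only [N]; omega) (by simp only [N]; omega)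
      (by simp only [N]; omega)) (h₁ N)
    -- Lengthening the blocks by what the loop deletes makes the run up to `j` end in the
    -- configuration that the original word reaches at `i`.
    have hj' := hreach hj (x' + N) (y' + N) (z' + N) N (by simp only [N]; omega) (by simp only [N]; omega)
      (by simp only [N]; omega)
    simp only [show x' + N - (x + x') = N - x by omega, show y' + N - (y + y') = N - y by omega,
      show z' + N - (z + z') = N - z by omega] at hj'
    have hj'' := hj'.trans hi'
    have hcount := h₂ hj''
    obtain rfl : y' = 2 * x' := by omega
    obtain rfl : x' = z' := by omega
    refine ⟨N, x', Nat.pos_of_ne_zero ?_, rfl, rfl, rfl, hj''⟩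
    -- A loop deleting nothing would be a cycle of configurations inside an accepting run.
    rintro rfl
    exact TransGen.not_reflTransGen_terminal hr A.not_step_accept
      (hstep N N N N (by simp only [N]; omega) (by simp only [N]; omega) (by simp only [N]; omega)) hi'
  -- Three visits to one state give two consecutive loops with positive `t`; together they have `t ≥
  -- 2`, as `h₃` requires.
  obtain ⟨q, hq⟩ := Finite.exists_infinite_fiber fun i => (p i).1
  rw [Set.infinite_coe_iff] at hq
  obtain ⟨i, hi⟩ := hq.nonempty
  obtain ⟨j, hj, hij⟩ := hq.exists_gt i
  obtain ⟨k, hk, hjk⟩ := hq.exists_gt j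
  simp only [Set.mem_preimage, Set.mem_singleton_iff] at hi hj hk
  obtain ⟨-, t₁, ht₁, h5, -⟩ := hloop i j hij (hi.trans hj.symm)
  obtain ⟨-, t₂, ht₂, h6, -⟩ := hloop j k hjk (hj.trans hk.symm)
  obtain ⟨N, t, -, h7, -, -, h8⟩ := hloop i k (hij.trans hjk) (hi.trans hk.symm)
  obtain ⟨t, rfl⟩ : ∃ t', t = t' + 2 := ⟨t - 2, by omega⟩
  exact h₃ t N h8

end RNFAwtl

/-! ### Transfer to the letters of an alphabet and the main theorem -/

theorem map_val_mem_image_iff {Γ : Type*} {s : Finset Γ} {M : Set (List s)} {w : List s} :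
    w.map Subtype.val ∈ List.map Subtype.val '' M ↔ w ∈ M :=
  (List.map_injective_iff.2 Subtype.val_injective).mem_set_image

/-- A second automaton for the same language may have another alphabet; this shows that it contains
the letters needed. -/
theorem mem_of_mem_image_map_val {Γ : Type*} {s : Finset Γ} {M : Set (List s)} {w : List Γ}
    (h : w ∈ List.map Subtype.val '' M) {x : Γ} (hx : x ∈ w) : x ∈ s := by
  obtain ⟨w, -, rfl⟩ := h
  obtain ⟨y, -, rfl⟩ := List.mem_map.1 hx
  exact y.2

theorem map_val_blockWord {Γ : Type*} {s : Finset Γ} (c a b : s) (n m l k : ℕ) :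
    (blockWord c a b n m l k).map Subtype.val = blockWord (c : Γ) a b n m l k := by
  simp [blockWord]

theorem not_classRDFAwtl_subset_classNROWJFA (Γ : Type*) [Infinite Γ] :
    ¬ classRDFAwtl Γ ⊆ classNROWJFA Γ := by
  classical
  obtain ⟨a, b, hab⟩ := exists_pair_ne Γ
  let s : Finset Γ := {a, b}
  let a' : s := ⟨a, by simp [s]⟩
  let b' : s := ⟨b, by simp [s]⟩
  have hab' : a' ≠ b' := fun h => hab (congrArg Subtype.val h)
  let L : Set (List Γ) := List.map Subtype.val '' (dyckAutomaton a' b' hab').language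
  intro hsub
  obtain ⟨s₂, Q, _, J, hJ⟩ := hsub (show L ∈ classRDFAwtl Γ from
    ⟨s, Bool, inferInstance, _, dyckAutomaton_isDeterministic a' b' hab', rfl⟩)
  have hL : ∀ n, List.replicate n a ++ List.replicate n b ∈ L := fun n =>
    ⟨_, replicate_append_replicate_mem_dyck a' b' hab' n, by simp [a', b']⟩
  have hL' : ∀ w ∈ L, w.count a = w.count b ∧ w.getLast? ≠ some a := by
    rintro _ ⟨w, hw, rfl⟩
    obtain ⟨h1, h2⟩ := count_eq_and_getLast?_ne_of_mem_dyck a' b' hab' w hw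
    constructor
    · have hcount (x : s) : (w.map Subtype.val).count (x : Γ) =
          @List.count s instBEqOfDecidableEq x w := by
        convert List.count_map_of_injective w _ Subtype.val_injective x
      exact (hcount a').trans (h1.trans (hcount b').symm)
    · rw [List.getLast?_map]
      intro h
      obtain ⟨x, hx, hxa⟩ := Option.map_eq_some_iff.1 h
      exact h2 (by rw [hx]; exact congrArg some (Subtype.ext hxa))
  have ha₂ : a ∈ s₂ := mem_of_mem_image_map_val (hJ ▸ hL 1) (by simp)
  have hb₂ : b ∈ s₂ := mem_of_mem_image_map_val (hJ ▸ hL 1) (by simp)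
  have hiff : ∀ w : List s₂, w ∈ J.language ↔ w.map Subtype.val ∈ L := fun w => by
    rw [hJ, map_val_mem_image_iff]
  obtain ⟨n, ⟨k, hk, h⟩ | ⟨d, hd, h⟩⟩ := J.exists_rotate_or_pump_mem_language
    (a := ⟨a, ha₂⟩) (b := ⟨b, hb₂⟩) fun n => by
      rw [hiff]
      simpa using hL n
  -- Because `k < n`, the rotated word ends in `a`.
  · refine (hL' _ ((hiff _).1 h)).2 ?_
    obtain ⟨d, hd⟩ := Nat.exists_eq_add_of_lt hk
    simp [show n - k = d + 1 by omega, List.replicate_succ']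
  · have := (hL' _ ((hiff _).1 h)).1
    simp [List.count_replicate, hab, hab.symm] at this
    omega

theorem not_classROWJFA_subset_classRDFAwtl (Γ : Type*) [Infinite Γ] :
    ¬ classROWJFA Γ ⊆ classRDFAwtl Γ := by
  classical
  let e := Infinite.natEmbedding Γ
  obtain ⟨c, a, b, hca, hcb, hab⟩ : ∃ c a b : Γ, c ≠ a ∧ c ≠ b ∧ a ≠ b :=
    ⟨e 0, e 1, e 2, by simp, by simp, by simp⟩
  let s : Finset Γ := {c, a, b}
  let c' : s := ⟨c, by simp [s]⟩
  let a' : s := ⟨a, by simp [s]⟩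
  let b' : s := ⟨b, by simp [s]⟩
  have hca' : c' ≠ a' := fun h => hca (congrArg Subtype.val h)
  have hcb' : c' ≠ b' := fun h => hcb (congrArg Subtype.val h)
  have hab' : a' ≠ b' := fun h => hab (congrArg Subtype.val h)
  let L : Set (List Γ) := List.map Subtype.val '' (balancedAutomaton c' a' b').language
  intro hsub
  obtain ⟨s₂, Q, _, A, hA, hL⟩ := hsub (show L ∈ classROWJFA Γ from
    ⟨s, Fin 5, inferInstance, _, balancedAutomaton_isDeterministic hca', rfl⟩)
  have hmem : ∀ n m l k, blockWord c a b n m l k ∈ L ↔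
      blockWord c' a' b' n m l k ∈ (balancedAutomaton c' a' b').language := fun n m l k => by
    rw [← map_val_mem_image_iff, map_val_blockWord]
  have h1 : blockWord c a b 1 1 1 1 ∈ L :=
    (hmem _ _ _ _).2 (blockWord_mem_balanced hca' hcb' hab' 1)
  have hc₂ : c ∈ s₂ := mem_of_mem_image_map_val (hL ▸ h1) (by simp [blockWord])
  have ha₂ : a ∈ s₂ := mem_of_mem_image_map_val (hL ▸ h1) (by simp [blockWord])
  have hb₂ : b ∈ s₂ := mem_of_mem_image_map_val (hL ▸ h1) (by simp [blockWord])
  have hiff : ∀ n m l k,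
      blockWord (⟨c, hc₂⟩ : s₂) ⟨a, ha₂⟩ ⟨b, hb₂⟩ n m l k ∈ A.language ↔
      blockWord c' a' b' n m l k ∈ (balancedAutomaton c' a' b').language := fun n m l k => by
    rw [← hmem, hL, ← map_val_mem_image_iff, map_val_blockWord]
  refine hA.not_forall_blockWord (c := ⟨c, hc₂⟩) (a := ⟨a, ha₂⟩) (b := ⟨b, hb₂⟩)
    (fun n => (hiff _ _ _ _).2 (blockWord_mem_balanced hca' hcb' hab' n))
    (fun h => eq_of_blockWord_mem_balanced hca' hcb' hab' ((hiff _ _ _ _).1 h))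
    (fun t k h => blockWord_notMem_balanced hca' hcb' hab' t k ((hiff _ _ _ _).1 h))

theorem classROWJFA_subset_classNROWJFA (Γ : Type*) : classROWJFA Γ ⊆ classNROWJFA Γ := by
  rintro L ⟨s, Q, hQ, J, -, hL⟩
  exact ⟨s, Q, hQ, J, hL⟩

theorem mainTheorem12 (Γ : Type*) [Infinite Γ] :
    (¬ classRDFAwtl Γ ⊆ classROWJFA Γ ∧ ¬ classROWJFA Γ ⊆ classRDFAwtl Γ) ∧
    (¬ classRDFAwtl Γ ⊆ classNROWJFA Γ ∧ ¬ classNROWJFA Γ ⊆ classRDFAwtl Γ) :=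
  have h₁ := not_classRDFAwtl_subset_classNROWJFA Γ
  have h₂ := not_classROWJFA_subset_classRDFAwtl Γ
  have h := classROWJFA_subset_classNROWJFA Γ
  ⟨⟨fun h' => h₁ (h'.trans h), h₂⟩, h₁, fun h' => h₂ (h.trans h')⟩
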